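/- Let $K$ be $\mathbb R$ or $\mathbb C$ and let $\lambda\neq\mu$ be elements of $K$. A skew-inner product is a bilinear form $\langle\cdot|\cdot\rangle$ on $K[z]$ with $\langle f|g\rangle=-\langle g|f\rangle$. Its (monic) skew orthogonal polynomials (SOPs) are monic polynomials $q_n$ with $\deg q_n=n$ ($n\ge 0$) such that, for all $m,n\ge 0$, $\langle q_{2m}|q_{2n+1}\rangle=r_n\delta_{mn}$ with $r_n\neq 0$, and $\langle q_{2m}|q_{2n}\rangle=\langle q_{2m+1}|q_{2n+1}\rangle=0$. Let $\langle\cdot|\cdot\rangle^{s,t}$ ($s,t=0,1,2,\dots$) be skew-inner products with $$\langle f|g\rangle^{s+1,t}=\langle (z-\mu)f|(z-\mu)g\rangle^{s,t},\qquad \langle f|g\rangle^{s,t+1}=\langle (z-\lambda)f|(z-\lambda)g\rangle^{s,t},$$ and suppose that for all $s,t$ there are SOPs $\{q_n^{s,t}(z)\}_{n\ge0}$ with respect to $\langle\cdot|\cdot\rangle^{s,t}$. Let $\tau_n^{s,t}$ be the Pfaffian of the $2n\times 2n$ matrix of moments $s_{i,j}=\langle z^i|z^j\rangle^{s,t}$,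 $0\le i,j\le 2n-1$, that is, $$\tau_n^{s,t}=\frac{1}{n!\,2^n}\sum_{\sigma\in\mathfrak S_{2n}}\operatorname{sgn}(\sigma)\prod_{i=0}^{n-1}s_{\sigma(2i),\sigma(2i+1)},\qquad \tau_0^{s,t}=1,$$ and put $\tau_{-1}^{s,t}=0$, $q_{-2}^{s,t}=0$. Then every $\tau_n^{s,t}$ with $n\ge0$ is nonzero, and for all $s,t,n\ge 0$ the SOPs of even degree satisfy $$(z-\lambda)\,q_{2n}^{s,t+1}(z)-(z-\mu)\,q_{2n}^{s+1,t}(z)=(z-\mu)(z-\lambda)A_n^{s,t}\,q_{2n-2}^{s+1,t+1}(z)-B_n^{s,t}\,q_{2n}^{s,t}(z),$$ $$(z-\mu)(z-\lambda)\,q_{2n}^{s+1,t+1}(z)-q_{2n+2}^{s,t}(z)=(z-\lambda)\,C_n^{s,t}\,q_{2n}^{s,t+1}(z)-(z-\mu)\,D_n^{s,t}\,q_{2n}^{s+1,t}(z),$$ where $$A_n^{s,t}=(\lambda-\mu)\frac{\tau_{n+1}^{s,t}\tau_{n-1}^{s+1,t+1}}{\tau_n^{s+1,t}\tau_n^{s,t+1}},\qquad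 B_n^{s,t}=(\lambda-\mu)\frac{\tau_n^{s,t}\tau_n^{s+1,t+1}}{\tau_n^{s+1,t}\tau_n^{s,t+1}},$$ $$C_n^{s,t}=(\lambda-\mu)^{-1}\frac{\tau_{n+1}^{s+1,t}\tau_n^{s,t+1}}{\tau_{n+1}^{s,t}\tau_n^{s+1,t+1}},\qquad D_n^{s,t}=(\lambda-\mu)^{-1}\frac{\tau_{n+1}^{s,t+1}\tau_n^{s+1,t}}{\tau_{n+1}^{s,t}\tau_n^{s+1,t+1}}.$$ -/

import Mathlib

open Polynomial

noncomputable section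

namespace SkewOP

variable {K : Type*} [RCLike K]

/-- A skew-inner product: a bilinear (not sesquilinear) form on polynomials that is
skew-symmetric. -/
def IsSkew (B : LinearMap.BilinForm K K[X]) : Prop :=
  ∀ f g : K[X], B f g = -B g f

/-- `q` is a sequence of monic skew-orthogonal polynomials, `q n` of degree `n`, with respect to
`B`.  The polynomials of odd degree are not normalised any further. -/
structure IsSOP (B : LinearMap.BilinForm K K[X]) (q : ℕ → K[X]) : Prop where
  monic : ∀ n, (q n).Monic
  natDegree_eq : ∀ n, (q n).natDegree = n
  even_odd : ∃ r : ℕ → K, (∀ n, r n ≠ 0) ∧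
    ∀ m n, B (q (2 * m)) (q (2 * n + 1)) = if m = n then r n else 0
  even_even : ∀ m n, B (q (2 * m)) (q (2 * n)) = 0
  odd_odd : ∀ m n, B (q (2 * m + 1)) (q (2 * n + 1)) = 0

/-- A family of skew-inner products `B s t` in which a unit step in `s` multiplies both arguments
by `z - μ` and a unit step in `t` multiplies both arguments by `z - lam`. -/
structure IsTimeEvolution (μ lam : K) (B : ℕ → ℕ → LinearMap.BilinForm K K[X]) : Prop where
  skew : ∀ s t, IsSkew (B s t)
  step_s : ∀ s t (f g : K[X]), B (s + 1) t f g = B s t ((X - C μ) * f) ((X - C μ) * g)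
  step_t : ∀ s t (f g : K[X]), B s (t + 1) f g = B s t ((X - C lam) * f) ((X - C lam) * g)

/-- The Pfaffian of a `2n × 2n` array, as a sum over all permutations divided by `n! 2 ^ n`. -/
def pfaffian {n : ℕ} (a : Fin (2 * n) → Fin (2 * n) → K) : K :=
  (∑ σ : Equiv.Perm (Fin (2 * n)), ((Equiv.Perm.sign σ : ℤ) : K) *
    ∏ i : Fin n, a (σ ⟨2 * (i : ℕ), by omega⟩) (σ ⟨2 * (i : ℕ) + 1, by omega⟩)) /
      ((n.factorial : K) * 2 ^ n)

/-- `τ_n`: the Pfaffian of the skew moments `⟨z ^ i | z ^ j⟩`, `0 ≤ i, j ≤ 2n - 1`. -/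
def tau (B : LinearMap.BilinForm K K[X]) (n : ℕ) : K :=
  pfaffian (n := n) fun i j => B (X ^ (i : ℕ)) (X ^ (j : ℕ))

/-- `τ_{n-1}`, with `τ_{-1} = 0`. -/
def tauPred (B : LinearMap.BilinForm K K[X]) : ℕ → K
  | 0 => 0
  | n + 1 => tau B n

/-- `q_{2n-2}`, with `q_{-2} = 0`. -/
def evenPred (q : ℕ → K[X]) : ℕ → K[X]
  | 0 => 0
  | n + 1 => q (2 * n)

/-- The coefficient `A_n^{s,t}`. -/
def coeffA (μ lam : K) (B : ℕ → ℕ → LinearMap.BilinForm K K[X]) (s t n : ℕ) : K :=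
  (lam - μ) * ((tau (B s t) (n + 1) * tauPred (B (s + 1) (t + 1)) n) /
    (tau (B (s + 1) t) n * tau (B s (t + 1)) n))

/-- The coefficient `B_n^{s,t}`. -/
def coeffB (μ lam : K) (B : ℕ → ℕ → LinearMap.BilinForm K K[X]) (s t n : ℕ) : K :=
  (lam - μ) * ((tau (B s t) n * tau (B (s + 1) (t + 1)) n) /
    (tau (B (s + 1) t) n * tau (B s (t + 1)) n))

/-- The coefficient `C_n^{s,t}`. -/
def coeffC (μ lam : K) (B : ℕ → ℕ → LinearMap.BilinForm K K[X]) (s t n : ℕ) : K :=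
  (lam - μ)⁻¹ * ((tau (B (s + 1) t) (n + 1) * tau (B s (t + 1)) n) /
    (tau (B s t) (n + 1) * tau (B (s + 1) (t + 1)) n))

/-- The coefficient `D_n^{s,t}`. -/
def coeffD (μ lam : K) (B : ℕ → ℕ → LinearMap.BilinForm K K[X]) (s t n : ℕ) : K :=
  (lam - μ)⁻¹ * ((tau (B s (t + 1)) (n + 1) * tau (B (s + 1) t) n) /
    (tau (B s t) (n + 1) * tau (B (s + 1) (t + 1)) n))

end SkewOP

end

/-!
Write `V_m` for the polynomials of degree less than `m`, and let `B` be a skew form with skew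
orthogonal polynomials `q`, `r_n = B (q_{2n}) (q_{2n+1})`.

*The forms.*  `q_{2n}` is orthogonal to `V_{2n+1}` (`IsSOP.even_orthogonal`), and `B` is
nondegenerate on `V_{2n}` (`IsSOP.eq_zero_of_orthogonal`).  So `q_{2n}` is, up to a factor, the only
element of `V_{2n+1}` orthogonal to `V_{2n}` (`IsSOP.eq_mul_of_orthogonal`).

*The Pfaffians.*  The Pfaffian of the array `B (v i) (v j)` is alternating in the vectors `v i`, so
a change of basis multiplies it by a determinant (`pfaffian_of_linearCombination`).  In the basis
`q_i` of `V_{2n}` the array is block diagonal, whence `τ_n = ∏_{i < n} r_i`: it is nonzero and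
`τ_{n+1} = τ_n r_n` (`IsSOP.tau_ne_zero`, `IsSOP.tau_succ`).  If `B'` arises from `B` by multiplying
both arguments by `z - a`, then `τ'_n = q_{2n}(a) τ_n` (`IsSOP.tau_mul_X_sub_C`), because `q_{2n}` is
in the radical of `B` on `V_{2n+1}`, and multiplication by `z - a` modulo `q_{2n}` has determinant
`q_{2n}(a)`.

*The relations.*  With these formulas the coefficients `B_n`, `C_n`, `D_n` are the ones for which,
in each relation, the terms other than the one with `A_n` add up to a polynomial that vanishes at
`μ` and at `λ`.  It is therefore `(z - μ) (z - λ) R` with `R` of low degree.  All the terms satisfy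
orthogonality relations, which pass to `R` with respect to the form at `(s + 1, t + 1)`; they force
`R` to be a multiple of `q_{2n-2}` in the first relation, and zero in the second.  The factor `A_n`
comes from pairing with `q_{2n-1}`.
-/

namespace SkewOP

variable {K : Type*} [RCLike K]

/-! ### Pfaffians and change of basis -/

/-- Exactly one factor of `∏ i, β (v (2i)) (v (2i+1))` involves a given entry of `v`, so the product
is linear in that entry. -/
theorem exists_linear_prod_update {V : Type*} [AddCommGroup V] [Module K V]
    (β : LinearMap.BilinForm K V) {n : ℕ} (v : Fin (2 * n) → V) (j : Fin (2 * n)) :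
    ∃ φ : V →ₗ[K] K, ∀ z, ∏ i : Fin n, β (Function.update v j z ⟨2 * (i : ℕ), by omega⟩)
      (Function.update v j z ⟨2 * (i : ℕ) + 1, by omega⟩) = φ z := by
  have hi : (j : ℕ) / 2 < n := by omega
  simp only [Fintype.prod_eq_mul_prod_compl (⟨(j : ℕ) / 2, hi⟩ : Fin n)]
  have hc : ∀ z : V, ∏ i ∈ {(⟨(j : ℕ) / 2, hi⟩ : Fin n)}ᶜ,
      β (Function.update v j z ⟨2 * (i : ℕ), by omega⟩)
        (Function.update v j z ⟨2 * (i : ℕ) + 1, by omega⟩) =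
      ∏ i ∈ {(⟨(j : ℕ) / 2, hi⟩ : Fin n)}ᶜ,
        β (v ⟨2 * (i : ℕ), by omega⟩) (v ⟨2 * (i : ℕ) + 1, by omega⟩) := by
    intro z
    refine Finset.prod_congr rfl fun i hmem => ?_
    have hne : (i : ℕ) ≠ (j : ℕ) / 2 := fun h => by simp [Fin.ext_iff, h] at hmem
    rw [Function.update_of_ne (Fin.ne_of_val_ne (by simp only; omega)),
      Function.update_of_ne (Fin.ne_of_val_ne (by simp only; omega))]
  simp only [hc]
  generalize ∏ i ∈ {(⟨(j : ℕ) / 2, hi⟩ : Fin n)}ᶜ,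
    β (v ⟨2 * (i : ℕ), by omega⟩) (v ⟨2 * (i : ℕ) + 1, by omega⟩) = c
  rcases Nat.even_or_odd' (j : ℕ) with ⟨k, hk | hk⟩
  · have e0 : (⟨2 * ((j : ℕ) / 2), by omega⟩ : Fin (2 * n)) = j := Fin.ext (by simp only; omega)
    have e1 : (⟨2 * ((j : ℕ) / 2) + 1, by omega⟩ : Fin (2 * n)) ≠ j :=
      Fin.ne_of_val_ne (by simp only; omega)
    exact ⟨c • β.flip (v ⟨2 * ((j : ℕ) / 2) + 1, by omega⟩), fun z => by
      simp [e0, Function.update_of_ne e1, mul_comm]⟩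
  · have e0 : (⟨2 * ((j : ℕ) / 2), by omega⟩ : Fin (2 * n)) ≠ j :=
      Fin.ne_of_val_ne (by simp only; omega)
    have e1 : (⟨2 * ((j : ℕ) / 2) + 1, by omega⟩ : Fin (2 * n)) = j :=
      Fin.ext (by simp only; omega)
    exact ⟨c • β (v ⟨2 * ((j : ℕ) / 2), by omega⟩), fun z => by
      simp [e1, Function.update_of_ne e0, mul_comm]⟩

/-- The multilinear map `v ↦ ∏ i, β (v (2i)) (v (2i+1))`, whose alternatization is, up to the
factor `n! 2 ^ n`, the Pfaffian of the array `β (v i) (v j)`. -/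
def pairingProd {V : Type*} [AddCommGroup V] [Module K V] (β : LinearMap.BilinForm K V) (n : ℕ) :
    MultilinearMap K (fun _ : Fin (2 * n) => V) K where
  toFun v := ∏ i : Fin n, β (v ⟨2 * (i : ℕ), by omega⟩) (v ⟨2 * (i : ℕ) + 1, by omega⟩)
  map_update_add' {inst} v j x y := by
    obtain rfl : inst = instDecidableEqFin _ := Subsingleton.elim _ _
    obtain ⟨φ, hφ⟩ := exists_linear_prod_update β v j
    rw [hφ, hφ, hφ, map_add]
  map_update_smul' {inst} v j c x := by
    obtain rfl : inst = instDecidableEqFin _ := Subsingleton.elim _ _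
    obtain ⟨φ, hφ⟩ := exists_linear_prod_update β v j
    rw [hφ, hφ, map_smul]

theorem pfaffian_eq_alternatization {V : Type*} [AddCommGroup V] [Module K V]
    (β : LinearMap.BilinForm K V) {n : ℕ} (v : Fin (2 * n) → V) :
    pfaffian (n := n) (fun i j => β (v i) (v j)) =
      MultilinearMap.alternatization (pairingProd β n) v / ((n.factorial : K) * 2 ^ n) := by
  rw [pfaffian, MultilinearMap.alternatization_apply]
  congr 1
  refine Finset.sum_congr rfl fun σ _ => ?_
  rw [Units.smul_def, zsmul_eq_mul]
  rfl

/-- The congruence rule `Pf (M A Mᵀ) = det M * Pf A`, for an array of values of a bilinear form: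
the Pfaffian is alternating in the vectors, hence a multiple of the determinant. -/
theorem pfaffian_of_linearCombination {V : Type*} [AddCommGroup V] [Module K V]
    (β : LinearMap.BilinForm K V) {n : ℕ} (p v : Fin (2 * n) → V)
    (M : Matrix (Fin (2 * n)) (Fin (2 * n)) K) (hv : ∀ i, v i = ∑ k, M i k • p k) :
    pfaffian (n := n) (fun i j => β (v i) (v j)) =
      M.det * pfaffian (n := n) fun i j => β (p i) (p j) := by
  let L : (Fin (2 * n) → K) →ₗ[K] V := Fintype.linearCombination K p
  let γ : LinearMap.BilinForm K (Fin (2 * n) → K) := β.compl₁₂ L L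
  have h1 : ∀ i j, β (v i) (v j) = γ (M i) (M j) := fun i j => by
    simp [γ, L, Fintype.linearCombination_apply, hv]
  have h2 : ∀ i j, β (p i) (p j) =
      γ (Pi.basisFun K (Fin (2 * n)) i) (Pi.basisFun K (Fin (2 * n)) j) := fun i j => by
    simp [γ, L]
  simp only [h1, h2]
  rw [pfaffian_eq_alternatization γ (fun i => M i),
    pfaffian_eq_alternatization γ (Pi.basisFun K (Fin (2 * n))),
    AlternatingMap.eq_smul_basis_det (Pi.basisFun K (Fin (2 * n)))
      (MultilinearMap.alternatization (pairingProd γ n)), AlternatingMap.smul_apply,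
    Pi.basisFun_det_apply, AlternatingMap.smul_apply, Module.Basis.det_self]
  simp only [smul_eq_mul, mul_one]
  rw [mul_comm, mul_div_assoc]
  rfl

/-! ### The Pfaffian of a block diagonal array -/

/-- The index `2i + ε` of `Fin (2n)` as the pair `(i, ε)`. -/
def pairEquiv (n : ℕ) : Fin n × Fin 2 ≃ Fin (2 * n) :=
  finProdFinEquiv.trans (finCongr (mul_comm n 2))

theorem pairEquiv_zero {n : ℕ} (i : Fin n) :
    pairEquiv n (i, 0) = ⟨2 * (i : ℕ), by omega⟩ := by
  ext; simp [pairEquiv]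

theorem pairEquiv_one {n : ℕ} (i : Fin n) :
    pairEquiv n (i, 1) = ⟨2 * (i : ℕ) + 1, by omega⟩ := by
  ext; simp [pairEquiv, add_comm]

theorem sign_prodShear {α β : Type*} [DecidableEq α] [Fintype α] [DecidableEq β] [Fintype β]
    (e : Equiv.Perm α) (s : α → Equiv.Perm β) :
    Equiv.Perm.sign (Equiv.prodShear e s) =
      Equiv.Perm.sign e ^ Fintype.card β * ∏ i, Equiv.Perm.sign (s i) := by
  have h : Equiv.prodShear e s =
      (Equiv.prodCongrLeft fun _ : β => e) * Equiv.prodCongrRight s := by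
    ext x <;> rfl
  rw [h, map_mul, Equiv.Perm.sign_prodCongrLeft, Equiv.Perm.sign_prodCongrRight]
  simp

/-- The Pfaffian of the block diagonal array with blocks `(0, r i; -r i, 0)` is `∏ i, r i`: the
permutations that contribute are those preserving the partition into pairs, and there are
`n! 2 ^ n` of these. -/
theorem pfaffian_eq_prod {n : ℕ} (a : Fin (2 * n) → Fin (2 * n) → K) (r : Fin n → K)
    (h01 : ∀ i j, a (pairEquiv n (i, 0)) (pairEquiv n (j, 1)) = if i = j then r i else 0)
    (h10 : ∀ i j, a (pairEquiv n (i, 1)) (pairEquiv n (j, 0)) = if i = j then -r i else 0)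
    (h00 : ∀ i j, a (pairEquiv n (i, 0)) (pairEquiv n (j, 0)) = 0)
    (h11 : ∀ i j, a (pairEquiv n (i, 1)) (pairEquiv n (j, 1)) = 0) :
    pfaffian a = ∏ i, r i := by
  have key : (∑ σ : Equiv.Perm (Fin (2 * n)), ((Equiv.Perm.sign σ : ℤ) : K) *
      ∏ i : Fin n, a (σ ⟨2 * (i : ℕ), by omega⟩) (σ ⟨2 * (i : ℕ) + 1, by omega⟩)) =
      ∑ x : Equiv.Perm (Fin n) × (Fin n → Equiv.Perm (Fin 2)), ∏ i, r i := by
    symm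
    refine Finset.sum_of_injOn
      (fun x => (pairEquiv n).permCongr (Equiv.prodShear x.1 x.2)) ?_ (by simp) ?_ ?_
    · rintro ⟨e, s⟩ - ⟨e', s'⟩ - h
      have h' := (pairEquiv n).permCongr.injective h
      have h2 : ∀ i ε, (e i, s i ε) = (e' i, s' i ε) := fun i ε =>
        congrArg (fun f : Equiv.Perm (Fin n × Fin 2) => f (i, ε)) h'
      refine Prod.ext (Equiv.ext fun i => (Prod.ext_iff.1 (h2 i 0)).1)
        (funext fun i => Equiv.ext fun ε => (Prod.ext_iff.1 (h2 i ε)).2)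
    · intro σ _ hσ
      by_contra hne
      refine hσ ?_
      obtain ⟨ρ, rfl⟩ := (pairEquiv n).permCongr.surjective σ
      have hfac : ∀ i, a (pairEquiv n (ρ (i, 0))) (pairEquiv n (ρ (i, 1))) ≠ 0 := by
        intro i
        have := Finset.prod_ne_zero_iff.1 (right_ne_zero_of_mul hne) i (Finset.mem_univ i)
        simpa [← pairEquiv_zero, ← pairEquiv_one, Equiv.permCongr_apply] using this
      have hblock : ∀ i, (ρ (i, 0)).1 = (ρ (i, 1)).1 := by
        intro i
        have := hfac i
        generalize ρ (i, 0) = x at this ⊢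
        generalize ρ (i, 1) = y at this ⊢
        obtain ⟨x, ε⟩ := x
        obtain ⟨y, δ⟩ := y
        by_contra hxy
        fin_cases ε <;> fin_cases δ <;> simp_all
      have hfst : ∀ i ε, (ρ (i, ε)).1 = (ρ (i, 0)).1 := by
        intro i ε
        fin_cases ε
        · rfl
        · exact (hblock i).symm
      have hsnd : ∀ i, Function.Injective fun ε => (ρ (i, ε)).2 := fun i ε δ h => by
        have := ρ.injective (Prod.ext ((hfst i ε).trans (hfst i δ).symm) h)
        exact (Prod.ext_iff.1 this).2
      have hsurj : Function.Surjective fun i => (ρ (i, 0)).1 := fun k => by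
        refine ⟨(ρ.symm (k, 0)).1, ?_⟩
        have := hfst (ρ.symm (k, 0)).1 (ρ.symm (k, 0)).2
        simpa using this.symm
      refine ⟨(Equiv.ofBijective _ (Finite.injective_iff_bijective.1
        (Finite.injective_iff_surjective.2 hsurj)), fun i => Equiv.ofBijective _
          (Finite.injective_iff_bijective.1 (hsnd i))), by simp, ?_⟩
      refine congrArg _ (Equiv.ext fun ⟨i, ε⟩ => Prod.ext ?_ rfl)
      exact (hfst i ε).symm
    · rintro ⟨e, s⟩ -
      simp only [Equiv.Perm.sign_permCongr, sign_prodShear, Fintype.card_fin, Int.units_sq,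
        one_mul, ← pairEquiv_zero, ← pairEquiv_one, Equiv.permCongr_apply,
        Equiv.symm_apply_apply]
      push_cast
      rw [← Finset.prod_mul_distrib, ← Equiv.prod_comp e r]
      refine Finset.prod_congr rfl fun i _ => ?_
      change r (e i) = _ * a (pairEquiv n (e i, s i 0)) (pairEquiv n (e i, s i 1))
      obtain h | h : s i = 1 ∨ s i = Equiv.swap 0 1 := by
        generalize s i = t
        revert t
        decide
      · simp [h, h01]
      · simp [h, h10]
  rw [pfaffian, key]
  have hf : (n.factorial : K) ≠ 0 := by exact_mod_cast n.factorial_ne_zero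
  rw [div_eq_iff (mul_ne_zero hf (pow_ne_zero _ two_ne_zero))]
  simp [Fintype.card_perm, mul_comm]

/-! ### Orthogonality and nondegeneracy -/

theorem degree_sub_coeff_mul_lt {f p : K[X]} {m : ℕ} (hf : f.degree < (m + 1 : ℕ))
    (hp : p.Monic) (hpm : p.natDegree = m) : (f - C (f.coeff m) * p).degree < m := by
  rw [degree_lt_iff_coeff_zero] at hf ⊢
  intro k hk
  rcases hk.eq_or_lt with rfl | hk
  · have : p.coeff m = 1 := by rw [← hpm]; exact hp
    simp [this]
  · simp [hf k hk, coeff_eq_zero_of_natDegree_lt (hpm.trans_lt hk)]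

theorem degree_lt_of_coeff_eq_zero {f : K[X]} {m : ℕ} (hf : f.degree < (m + 1 : ℕ))
    (h : f.coeff m = 0) : f.degree < m := by
  simpa [h] using degree_sub_coeff_mul_lt hf (monic_X_pow m) (natDegree_X_pow m)

theorem degree_X_sub_C_mul_lt {f : K[X]} {m : ℕ} (a : K) (hf : f.degree < m) :
    ((X - C a) * f).degree < ((m + 1 : ℕ) : WithBot ℕ) := by
  rw [mul_comm, (monic_X_sub_C a).degree_mul, degree_X_sub_C]
  push_cast
  exact WithBot.add_lt_add_right (by simp) hf

theorem degree_lt_of_degree_X_sub_C_mul_lt {f : K[X]} {m : ℕ} (a : K)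
    (hf : ((X - C a) * f).degree < ((m + 1 : ℕ) : WithBot ℕ)) : f.degree < m := by
  rw [mul_comm, (monic_X_sub_C a).degree_mul, degree_X_sub_C] at hf
  push_cast at hf
  exact lt_of_add_lt_add_right hf

namespace IsSOP

variable {B : LinearMap.BilinForm K K[X]} {q : ℕ → K[X]}

theorem degree_lt (h : IsSOP B q) {m k : ℕ} (hk : m < k) : (q m).degree < k := by
  rw [degree_eq_natDegree (h.monic m).ne_zero, h.natDegree_eq]
  exact_mod_cast hk

theorem coeff_self (h : IsSOP B q) (m : ℕ) : (q m).coeff m = 1 := by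
  have := h.monic m
  rwa [Monic, leadingCoeff, h.natDegree_eq] at this

theorem pairing_ne_zero (h : IsSOP B q) (n : ℕ) : B (q (2 * n)) (q (2 * n + 1)) ≠ 0 := by
  obtain ⟨r, hr, hB⟩ := h.even_odd
  simpa [hB] using hr n

theorem pairing_of_ne (h : IsSOP B q) {m n : ℕ} (hmn : m ≠ n) :
    B (q (2 * m)) (q (2 * n + 1)) = 0 := by
  obtain ⟨r, hr, hB⟩ := h.even_odd
  simp [hB, hmn]

/-- `q_{2n}` is orthogonal to all polynomials of degree less than `2n + 1`, itself included. -/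
theorem even_orthogonal (h : IsSOP B q) (n : ℕ) {f : K[X]}
    (hf : f.degree < (2 * n + 1 : ℕ)) : B (q (2 * n)) f = 0 := by
  suffices H : ∀ m ≤ 2 * n + 1, ∀ f : K[X], f.degree < m → B (q (2 * n)) f = 0 from
    H _ le_rfl f hf
  intro m
  induction m with
  | zero =>
    intro _ f hf
    simp [degree_eq_bot.1 (Nat.WithBot.lt_zero_iff.1 hf)]
  | succ m ih =>
    intro hm f hf
    have h1 := ih (by omega) _ (degree_sub_coeff_mul_lt hf (h.monic m) (h.natDegree_eq m))
    have h2 : B (q (2 * n)) (q m) = 0 := by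
      rcases Nat.even_or_odd' m with ⟨k, rfl | rfl⟩
      · exact h.even_even n k
      · exact h.pairing_of_ne (by omega)
    simpa [← smul_eq_C_mul, h2] using h1

/-- The first pairing of `q_{2n}` that does not vanish sees the leading coefficient only. -/
theorem even_pairing (h : IsSOP B q) (n : ℕ) {f : K[X]} (hf : f.degree < (2 * n + 2 : ℕ)) :
    B (q (2 * n)) f = f.coeff (2 * n + 1) * B (q (2 * n)) (q (2 * n + 1)) := by
  have h1 := h.even_orthogonal n (degree_sub_coeff_mul_lt hf (h.monic _) (h.natDegree_eq _))
  simpa [← smul_eq_C_mul, sub_eq_zero] using h1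

/-- A skew form that admits skew orthogonal polynomials is nondegenerate on the polynomials of
degree less than `2n`. -/
theorem eq_zero_of_orthogonal (hB : IsSkew B) (h : IsSOP B q) (n : ℕ) {f : K[X]}
    (hf : f.degree < (2 * n : ℕ)) (horth : ∀ g : K[X], g.degree < (2 * n : ℕ) → B f g = 0) :
    f = 0 := by
  induction n generalizing f with
  | zero => exact degree_eq_bot.1 (Nat.WithBot.lt_zero_iff.1 (by simpa using hf))
  | succ n ih =>
    have h1 : f.coeff (2 * n + 1) = 0 := by
      have := horth (q (2 * n)) (h.degree_lt (by omega))
      rw [hB, h.even_pairing n hf, neg_eq_zero] at this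
      exact (mul_eq_zero.1 this).resolve_right (h.pairing_ne_zero n)
    have hf' := degree_lt_of_coeff_eq_zero hf h1
    have h2 : f - C (f.coeff (2 * n)) * q (2 * n) = 0 := by
      refine ih (degree_sub_coeff_mul_lt hf' (h.monic _) (h.natDegree_eq _)) fun g hg => ?_
      have h3 := horth g (hg.trans (by exact_mod_cast (by omega : 2 * n < 2 * (n + 1))))
      have h4 := h.even_orthogonal n (hg.trans (by exact_mod_cast (by omega : 2 * n < 2 * n + 1)))
      simp [← smul_eq_C_mul, h3, h4]
    have h3 := horth (q (2 * n + 1)) (h.degree_lt (by omega))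
    rw [sub_eq_zero.1 h2, ← smul_eq_C_mul, map_smul, LinearMap.smul_apply, smul_eq_mul] at h3
    rw [sub_eq_zero.1 h2, (mul_eq_zero.1 h3).resolve_right (h.pairing_ne_zero n)]
    simp

/-- The polynomials of degree at most `2n` that are orthogonal to those of degree less than `2n`
are the multiples of `q_{2n}`. -/
theorem eq_mul_of_orthogonal (hB : IsSkew B) (h : IsSOP B q) (n : ℕ) {f : K[X]}
    (hf : f.degree < (2 * n + 1 : ℕ))
    (horth : ∀ g : K[X], g.degree < (2 * n : ℕ) → B f g = 0) :
    f = C (f.coeff (2 * n)) * q (2 * n) := by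
  refine sub_eq_zero.1 (h.eq_zero_of_orthogonal hB n
    (degree_sub_coeff_mul_lt hf (h.monic _) (h.natDegree_eq _)) fun g hg => ?_)
  have h4 := h.even_orthogonal n (hg.trans (by exact_mod_cast (by omega : 2 * n < 2 * n + 1)))
  simp [← smul_eq_C_mul, horth g hg, h4]

end IsSOP

/-! ### The moment Pfaffians -/

theorem eq_sum_coeff_smul_X_pow {f : K[X]} {m : ℕ} (hf : f.degree < m) :
    f = ∑ k : Fin m, f.coeff k • (X : K[X]) ^ (k : ℕ) := by
  rw [Fin.sum_univ_eq_sum_range (fun k => f.coeff k • (X : K[X]) ^ k)]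
  ext j
  simp only [finsetSum_coeff, coeff_smul, coeff_X_pow, smul_eq_mul, mul_ite, mul_one, mul_zero,
    Finset.sum_ite_eq, Finset.mem_range]
  split_ifs with hj
  · rfl
  · exact (degree_lt_iff_coeff_zero _ _).1 hf j (not_lt.1 hj)

/-- The moments may be taken in any basis of monic polynomials, as the change of basis is
unitriangular. -/
theorem tau_eq_pfaffian_of_monic (B : LinearMap.BilinForm K K[X]) (n : ℕ) {p : ℕ → K[X]}
    (hp : ∀ k, (p k).Monic) (hdeg : ∀ k, (p k).natDegree = k) :
    tau B n = pfaffian (n := n) fun i j => B (p i) (p j) := by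
  have hlt : ∀ {i k : ℕ}, i < k → (p i).degree < k := fun {i k} hik => by
    rw [degree_eq_natDegree (hp i).ne_zero, hdeg]
    exact_mod_cast hik
  have hdet : (Matrix.of fun i k : Fin (2 * n) => (p i).coeff k).det = 1 := by
    rw [Matrix.det_of_isLowerTriangular]
    · refine Finset.prod_eq_one fun i _ => ?_
      have := hp i
      rwa [Monic, leadingCoeff, hdeg] at this
    · intro i k hik
      exact coeff_eq_zero_of_degree_lt (hlt (show (i : ℕ) < k from hik))
  rw [pfaffian_of_linearCombination B (fun k : Fin (2 * n) => (X : K[X]) ^ (k : ℕ))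
    (fun i => p i) (Matrix.of fun i k : Fin (2 * n) => (p i).coeff k)
      fun i => eq_sum_coeff_smul_X_pow (hlt i.2)]
  rw [hdet, one_mul]
  rfl

theorem IsSOP.tau_eq_prod {B : LinearMap.BilinForm K K[X]} {q : ℕ → K[X]} (hB : IsSkew B)
    (h : IsSOP B q) (n : ℕ) :
    tau B n = ∏ i : Fin n, B (q (2 * (i : ℕ))) (q (2 * (i : ℕ) + 1)) := by
  rw [tau_eq_pfaffian_of_monic B n h.monic h.natDegree_eq]
  refine pfaffian_eq_prod _ _ ?_ ?_ ?_ ?_ <;> intro i j <;>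
    simp only [pairEquiv_zero, pairEquiv_one]
  · split_ifs with hij
    · rw [hij]
    · exact h.pairing_of_ne fun h => hij (Fin.ext h)
  · rw [hB]
    split_ifs with hij
    · rw [hij]
    · rw [h.pairing_of_ne fun h => hij (Fin.ext h.symm), neg_zero]
  · exact h.even_even _ _
  · exact h.odd_odd _ _

theorem IsSOP.tau_ne_zero {B : LinearMap.BilinForm K K[X]} {q : ℕ → K[X]} (hB : IsSkew B)
    (h : IsSOP B q) (n : ℕ) : tau B n ≠ 0 := by
  rw [h.tau_eq_prod hB]
  exact Finset.prod_ne_zero_iff.2 fun i _ => h.pairing_ne_zero i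

theorem IsSOP.tau_succ {B : LinearMap.BilinForm K K[X]} {q : ℕ → K[X]} (hB : IsSkew B)
    (h : IsSOP B q) (n : ℕ) :
    tau B (n + 1) = tau B n * B (q (2 * n)) (q (2 * n + 1)) := by
  rw [h.tau_eq_prod hB, h.tau_eq_prod hB, Fin.prod_univ_castSucc]
  simp

/-- For `Q` monic of degree `m + 1`, the matrix is that of multiplication by `X` modulo `Q` in the
basis of the powers of `X`: its first column has a single entry, with an identity minor. -/
theorem det_companion {m : ℕ} (Q : K[X]) :
    (Matrix.of fun i k : Fin (m + 1) =>
      ((X : K[X]) ^ ((i : ℕ) + 1) - if i = Fin.last m then Q else 0).coeff k).det =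
      (-1) ^ (m + 1) * Q.coeff 0 := by
  rw [Matrix.det_succ_column_zero, Finset.sum_eq_single (Fin.last m)]
  · have : (Matrix.of fun i k : Fin (m + 1) =>
      ((X : K[X]) ^ ((i : ℕ) + 1) - if i = Fin.last m then Q else 0).coeff k).submatrix
        (Fin.last m).succAbove Fin.succ = 1 := by
      ext i k
      simp [Matrix.one_apply, coeff_X_pow, Fin.ext_iff, Fin.succAbove_last, i.2.ne', eq_comm]
    rw [this]
    simp [pow_succ]
  · intro i _ hi
    simp [hi]
  · simp

/-- If all arguments are multiplied by `z - a`, then `τ_n` is multiplied by `q_{2n}(a)`.  Indeed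
`q_{2n}` lies in the radical of the form on the polynomials of degree at most `2n`, so that
multiplication by `z - a` may be taken modulo `q_{2n}`, where its determinant is `q_{2n}(a)`. -/
theorem IsSOP.tau_mul_X_sub_C {B B' : LinearMap.BilinForm K K[X]} {q : ℕ → K[X]}
    (hB : IsSkew B) (h : IsSOP B q) (a : K)
    (hB' : ∀ f g, B' f g = B ((X - C a) * f) ((X - C a) * g)) (n : ℕ) :
    tau B' n = (q (2 * n)).eval a * tau B n := by
  have hmon : ∀ k : ℕ, ((X - C a) ^ k).Monic := fun k => (monic_X_sub_C a).pow k
  have hdeg : ∀ k : ℕ, ((X - C a) ^ k).natDegree = k := fun k => by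
    simp [natDegree_pow]
  rw [tau_eq_pfaffian_of_monic B' n hmon hdeg, tau_eq_pfaffian_of_monic B n hmon hdeg]
  cases n with
  | zero =>
    have : q 0 = 1 := (h.monic 0).natDegree_eq_zero.1 (h.natDegree_eq 0)
    simp [pfaffian, this]
  | succ n =>
    -- `u i` is `(z - a) ^ (i + 1)` reduced modulo `Q`
    let Q := q (2 * (n + 1))
    let m := 2 * n + 1
    let u : Fin (m + 1) → K[X] := fun i =>
      (X - C a) ^ ((i : ℕ) + 1) - if i = Fin.last m then Q else 0
    have hQ : ∀ i : Fin (m + 1), ∀ f : K[X], f.degree < (2 * (n + 1) + 1 : ℕ) →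
        B (if i = Fin.last m then Q else 0) f = 0 := fun i f hf => by
      split_ifs
      · exact h.even_orthogonal (n + 1) hf
      · simp
    have hpow : ∀ i : Fin (m + 1), ((X - C a) ^ ((i : ℕ) + 1)).degree <
        ((2 * (n + 1) + 1 : ℕ) : WithBot ℕ) :=
      fun i => by
        rw [degree_eq_natDegree (hmon _).ne_zero, hdeg]
        have := i.2
        exact_mod_cast (by omega)
    have hQdeg : ∀ i : Fin (m + 1),
        (if i = Fin.last m then Q else 0).degree < (2 * (n + 1) + 1 : ℕ) := fun i => by
      split_ifs
      · exact h.degree_lt (by omega)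
      · exact degree_zero.trans_lt (WithBot.bot_lt_coe _)
    have hu : ∀ i j : Fin (m + 1), B' ((X - C a) ^ (i : ℕ)) ((X - C a) ^ (j : ℕ)) =
        B (u i) (u j) := fun i j => by
      simp only [hB', ← pow_succ', u, map_sub, LinearMap.sub_apply]
      rw [hQ i _ (hpow j), hQ i _ (hQdeg j), hB _ (ite _ _ _), hQ j _ (hpow i)]
      simp
    have hudeg : ∀ i, (u i).degree < (m + 1 : ℕ) := fun i => by
      by_cases hi : i = Fin.last m
      · subst hi
        have := degree_sub_lt_left (p := (X - C a) ^ (m + 1)) (q := Q)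
          (by rw [degree_eq_natDegree (hmon _).ne_zero, hdeg,
            degree_eq_natDegree (h.monic _).ne_zero, h.natDegree_eq]; rfl)
          (hmon _).ne_zero (by rw [(hmon _).leadingCoeff, (h.monic _).leadingCoeff])
        rw [degree_eq_natDegree (hmon _).ne_zero, hdeg] at this
        simpa [u] using this
      · have : (i : ℕ) + 1 < m + 1 := by
          have := Fin.val_lt_last hi
          omega
        simp only [u, hi, if_false, sub_zero]
        rw [degree_eq_natDegree (hmon _).ne_zero, hdeg]
        exact_mod_cast this
    have htay : ∀ i, taylor a (u i) =
        (X : K[X]) ^ ((i : ℕ) + 1) - if i = Fin.last m then taylor a Q else 0 := fun i => by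
      have : taylor a ((X - C a) ^ ((i : ℕ) + 1)) = (X : K[X]) ^ ((i : ℕ) + 1) := by
        simp [taylor_pow]
      simp only [u, map_sub, this]
      split_ifs <;> simp
    have hlin : ∀ i, u i = ∑ k : Fin (m + 1), (taylor a (u i)).coeff k • (X - C a) ^ (k : ℕ) :=
      fun i => by
        have h1 := congrArg (taylor (-a))
          (eq_sum_coeff_smul_X_pow (f := taylor a (u i)) (m := m + 1)
            (by rw [degree_taylor]; exact hudeg i))
        simpa [taylor_taylor, ← sub_eq_add_neg] using h1
    have key := pfaffian_of_linearCombination (n := n + 1) B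
      (fun k => (X - C a) ^ (k : ℕ)) u
      (Matrix.of fun i k : Fin (m + 1) => (taylor a (u i)).coeff k) hlin
    simp only [htay] at key
    have hdet := det_companion (m := m) (taylor a Q)
    have hone : (-1 : K) ^ (m + 1) = 1 := Even.neg_one_pow ⟨n + 1, by omega⟩
    rw [hone, one_mul, taylor_coeff_zero] at hdet
    rw [hdet] at key
    rw [← key]
    congr 1
    funext i j
    exact hu i j

/-! ### The relations between neighbouring families -/

theorem exists_eq_X_sub_C_mul_X_sub_C_mul {a b : K} (hab : a ≠ b) {P : K[X]}
    (ha : P.eval a = 0) (hb : P.eval b = 0) : ∃ R, P = (X - C a) * ((X - C b) * R) := by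
  obtain ⟨R, hR⟩ := (isCoprime_X_sub_C_of_isUnit_sub (sub_ne_zero.2 hab).isUnit).mul_dvd
    (dvd_iff_isRoot.2 ha) (dvd_iff_isRoot.2 hb)
  exact ⟨R, by rw [hR, mul_assoc]⟩

namespace IsTimeEvolution

variable {μ lam : K} {B : ℕ → ℕ → LinearMap.BilinForm K K[X]} {q : ℕ → ℕ → ℕ → K[X]}

theorem step_st (hB : IsTimeEvolution μ lam B) (s t : ℕ) (f g : K[X]) :
    B (s + 1) (t + 1) f g =
      B s t ((X - C μ) * ((X - C lam) * f)) ((X - C μ) * ((X - C lam) * g)) := by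
  rw [hB.step_t, hB.step_s]

theorem pairing_X_sub_mu_mul (hB : IsTimeEvolution μ lam B) (s t : ℕ) (f g : K[X]) :
    B s t ((X - C μ) * f) ((X - C μ) * ((X - C lam) * g)) = B (s + 1) t f ((X - C lam) * g) :=
  (hB.step_s ..).symm

theorem pairing_X_sub_lam_mul (hB : IsTimeEvolution μ lam B) (s t : ℕ) (f g : K[X]) :
    B s t ((X - C lam) * f) ((X - C μ) * ((X - C lam) * g)) = B s (t + 1) f ((X - C μ) * g) := by
  rw [mul_left_comm (X - C μ), hB.step_t]

theorem tau_succ_left (hB : IsTimeEvolution μ lam B) (hq : ∀ s t, IsSOP (B s t) (q s t))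
    (s t n : ℕ) : tau (B (s + 1) t) n = (q s t (2 * n)).eval μ * tau (B s t) n :=
  (hq s t).tau_mul_X_sub_C (hB.skew s t) μ (hB.step_s s t) n

theorem tau_succ_right (hB : IsTimeEvolution μ lam B) (hq : ∀ s t, IsSOP (B s t) (q s t))
    (s t n : ℕ) : tau (B s (t + 1)) n = (q s t (2 * n)).eval lam * tau (B s t) n :=
  (hq s t).tau_mul_X_sub_C (hB.skew s t) lam (hB.step_t s t) n

/-- With `P` the left side plus `B_n q_{2n}`, the value of `B_n` makes `P` vanish at `μ` and `lam`,
and the cofactor of `(z - μ) (z - lam)` in `P` is orthogonal to the polynomials of degree less than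
`2n - 2`, hence a multiple of `q_{2n-2}`.  Pairing with `q_{2n-1}` gives the factor. -/
theorem first_relation (hne : lam ≠ μ) (hB : IsTimeEvolution μ lam B)
    (hq : ∀ s t, IsSOP (B s t) (q s t)) (s t n : ℕ) :
    (X - C lam) * q s (t + 1) (2 * n) - (X - C μ) * q (s + 1) t (2 * n) =
      (X - C μ) * (X - C lam) * (C (coeffA μ lam B s t n) * evenPred (q (s + 1) (t + 1)) n) -
        C (coeffB μ lam B s t n) * q s t (2 * n) := by
  have hτ : ∀ s t n, tau (B s t) n ≠ 0 := fun s t n => (hq s t).tau_ne_zero (hB.skew s t) n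
  have h10 := hτ (s + 1) t n
  have h01 := hτ s (t + 1) n
  set b := coeffB μ lam B s t n with hb
  set P := (X - C lam) * q s (t + 1) (2 * n) - (X - C μ) * q (s + 1) t (2 * n) +
    C b * q s t (2 * n) with hP
  have hμ : P.eval μ = 0 := by
    have e1 := tau_succ_left hB hq s t n
    have e2 := tau_succ_left hB hq s (t + 1) n
    simp only [hP, eval_add, eval_sub, eval_mul, eval_X, eval_C, sub_self, zero_mul, sub_zero]
    rw [hb, coeffB, e2]
    field_simp
    rw [e1]
    ring
  have hlam : P.eval lam = 0 := by
    have e1 := tau_succ_right hB hq s t n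
    have e2 := tau_succ_right hB hq (s + 1) t n
    simp only [hP, eval_add, eval_sub, eval_mul, eval_X, eval_C, sub_self, zero_mul, zero_sub]
    rw [hb, coeffB, e2]
    field_simp
    rw [e1]
    ring
  obtain ⟨R, hR⟩ := exists_eq_X_sub_C_mul_X_sub_C_mul hne.symm hμ hlam
  have hPdeg : P.degree < ((2 * n + 1 : ℕ) : WithBot ℕ) := by
    have hd : ∀ (a : K) (s t : ℕ), ((X - C a) * q s t (2 * n)).degree <
        ((2 * n + 1 + 1 : ℕ) : WithBot ℕ) := fun a s t =>
      degree_X_sub_C_mul_lt a ((hq s t).degree_lt (by omega))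
    have hc : ∀ (a : K) (s t : ℕ), ((X - C a) * q s t (2 * n)).coeff (2 * n + 1) = 1 :=
      fun a s t => by
        have h2 : (q s t (2 * n)).coeff (2 * n + 1) = 0 :=
          coeff_eq_zero_of_degree_lt ((hq s t).degree_lt (by omega))
        simp [sub_mul, coeff_X_mul, (hq s t).coeff_self, h2]
    have hq0 : (C b * q s t (2 * n)).degree < ((2 * n + 1 : ℕ) : WithBot ℕ) := by
      rw [← smul_eq_C_mul]
      exact (degree_smul_le _ _).trans_lt ((hq s t).degree_lt (by omega))
    refine (degree_add_le _ _).trans_lt (max_lt ?_ hq0)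
    refine degree_lt_of_coeff_eq_zero
      ((degree_sub_le _ _).trans_lt (max_lt (hd _ _ _) (hd _ _ _))) ?_
    rw [coeff_sub, hc, hc, sub_self]
  have hpair : ∀ g : K[X], g.degree < (2 * n : ℕ) → B (s + 1) (t + 1) R g =
      b * B s t (q s t (2 * n)) ((X - C μ) * ((X - C lam) * g)) := by
    intro g hg
    rw [hB.step_st, ← hR, hP, map_add, map_sub, ← smul_eq_C_mul, map_smul]
    simp only [LinearMap.add_apply, LinearMap.sub_apply, LinearMap.smul_apply, smul_eq_mul]
    rw [hB.pairing_X_sub_mu_mul, hB.pairing_X_sub_lam_mul,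
      (hq _ _).even_orthogonal n (degree_X_sub_C_mul_lt _ hg),
      (hq _ _).even_orthogonal n (degree_X_sub_C_mul_lt _ hg), sub_zero, zero_add]
  have hfin : P = (X - C μ) * (X - C lam) *
      (C (coeffA μ lam B s t n) * evenPred (q (s + 1) (t + 1)) n) := by
    rw [hR] at hPdeg ⊢
    cases n with
    | zero =>
      -- `P` is a constant with a zero
      have hR0 : R = 0 := by
        by_contra h0
        rw [(monic_X_sub_C μ).degree_mul_comm, (monic_X_sub_C μ).degree_mul,
          (monic_X_sub_C lam).degree_mul_comm, (monic_X_sub_C lam).degree_mul,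
          degree_eq_natDegree h0, degree_X_sub_C, degree_X_sub_C] at hPdeg
        have : R.natDegree + 1 + 1 < 1 := by exact_mod_cast hPdeg
        omega
      simp [hR0, evenPred]
    | succ n =>
      have hRdeg : R.degree < ((2 * n + 1 : ℕ) : WithBot ℕ) :=
        degree_lt_of_degree_X_sub_C_mul_lt lam (degree_lt_of_degree_X_sub_C_mul_lt μ hPdeg)
      have hRq := (hq (s + 1) (t + 1)).eq_mul_of_orthogonal (hB.skew _ _) n hRdeg fun g hg => by
        -- `q_{2n+2}` is orthogonal to `(z - μ) (z - lam) g`, of degree at most `2n + 1`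
        rw [hpair g (hg.trans (by exact_mod_cast (by omega : 2 * n < 2 * (n + 1)))),
          (hq s t).even_orthogonal (n + 1), mul_zero]
        exact (degree_X_sub_C_mul_lt _ (degree_X_sub_C_mul_lt _ hg)).trans
          (by exact_mod_cast (by omega : 2 * n + 1 + 1 < 2 * (n + 1) + 1))
      have hcoeff : R.coeff (2 * n) = coeffA μ lam B s t (n + 1) := by
        have hr1 := (hq (s + 1) (t + 1)).pairing_ne_zero n
        have h1 := hpair (q (s + 1) (t + 1) (2 * n + 1)) ((hq _ _).degree_lt (by omega))
        rw [hRq, ← smul_eq_C_mul, map_smul, LinearMap.smul_apply, smul_eq_mul,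
          (hq s t).even_pairing (n + 1)] at h1
        · have h2 : ((X - C μ) * ((X - C lam) * q (s + 1) (t + 1) (2 * n + 1))).coeff
              (2 * (n + 1) + 1) = 1 := by
            have hm : ((X - C μ) * ((X - C lam) * q (s + 1) (t + 1) (2 * n + 1))).Monic :=
              (monic_X_sub_C μ).mul ((monic_X_sub_C lam).mul ((hq _ _).monic _))
            have hd : ((X - C μ) * ((X - C lam) * q (s + 1) (t + 1) (2 * n + 1))).natDegree =
                2 * (n + 1) + 1 := by
              rw [(monic_X_sub_C μ).natDegree_mul ((monic_X_sub_C lam).mul ((hq _ _).monic _)),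
                (monic_X_sub_C lam).natDegree_mul ((hq _ _).monic _), natDegree_X_sub_C,
                natDegree_X_sub_C, (hq _ _).natDegree_eq]
              ring
            rwa [Monic, leadingCoeff, hd] at hm
          rw [h2, one_mul] at h1
          refine mul_right_cancel₀ hr1 (h1.trans ?_)
          rw [hb, coeffA, coeffB, (hq s t).tau_succ (hB.skew s t) (n + 1), tauPred,
            (hq (s + 1) (t + 1)).tau_succ (hB.skew _ _) n]
          ring
        · exact degree_X_sub_C_mul_lt μ (degree_X_sub_C_mul_lt lam ((hq _ _).degree_lt
            (Nat.lt_succ_self _)))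
      rw [← hcoeff, evenPred, ← hRq, mul_assoc]
  rw [← hfin, hP]
  ring

/-- The values of `C_n` and `D_n` make the difference of the two sides vanish at `μ` and `lam`; the
cofactor of `(z - μ) (z - lam)` has degree less than `2n` and is orthogonal to all polynomials of
degree less than `2n`, hence is zero. -/
theorem second_relation (hne : lam ≠ μ) (hB : IsTimeEvolution μ lam B)
    (hq : ∀ s t, IsSOP (B s t) (q s t)) (s t n : ℕ) :
    (X - C μ) * (X - C lam) * q (s + 1) (t + 1) (2 * n) - q s t (2 * n + 2) =
      (X - C lam) * (C (coeffC μ lam B s t n) * q s (t + 1) (2 * n)) -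
        (X - C μ) * (C (coeffD μ lam B s t n) * q (s + 1) t (2 * n)) := by
  have hτ : ∀ s t n, tau (B s t) n ≠ 0 := fun s t n => (hq s t).tau_ne_zero (hB.skew s t) n
  have h00 := hτ s t (n + 1)
  have h11 := hτ (s + 1) (t + 1) n
  have hsub : lam - μ ≠ 0 := sub_ne_zero.2 hne
  set c := coeffC μ lam B s t n with hc
  set d := coeffD μ lam B s t n with hd
  have hqq : q s t (2 * n + 2) = q s t (2 * (n + 1)) := rfl
  set P := (X - C μ) * ((X - C lam) * q (s + 1) (t + 1) (2 * n)) - q s t (2 * (n + 1)) -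
    ((X - C lam) * (C c * q s (t + 1) (2 * n)) - (X - C μ) * (C d * q (s + 1) t (2 * n))) with hP
  have hμ : P.eval μ = 0 := by
    have e1 := tau_succ_left hB hq s t (n + 1)
    have e2 := tau_succ_left hB hq s (t + 1) n
    simp only [hP, eval_sub, eval_mul, eval_X, eval_C, sub_self, zero_mul, sub_zero, zero_sub]
    rw [hc, coeffC, e1]
    field_simp
    rw [e2]
    ring
  have hlam : P.eval lam = 0 := by
    have e1 := tau_succ_right hB hq s t (n + 1)
    have e2 := tau_succ_right hB hq (s + 1) t n
    simp only [hP, eval_sub, eval_mul, eval_X, eval_C, sub_self, zero_mul, mul_zero, zero_sub]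
    rw [hd, coeffD, e1]
    field_simp
    rw [e2]
    ring
  obtain ⟨R, hR⟩ := exists_eq_X_sub_C_mul_X_sub_C_mul hne.symm hμ hlam
  have hPdeg : P.degree < ((2 * n + 1 + 1 : ℕ) : WithBot ℕ) := by
    have hlt : ∀ s t, (q s t (2 * n)).degree < ((2 * n + 1 : ℕ) : WithBot ℕ) := fun s t =>
      (hq s t).degree_lt (by omega)
    have hsm : ∀ (a e : K) (s t : ℕ), ((X - C a) * (C e * q s t (2 * n))).degree <
        ((2 * n + 1 + 1 : ℕ) : WithBot ℕ) := fun a e s t => by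
      rw [← smul_eq_C_mul]
      exact degree_X_sub_C_mul_lt a ((degree_smul_le _ _).trans_lt (hlt s t))
    refine (degree_sub_le _ _).trans_lt (max_lt ?_
      ((degree_sub_le _ _).trans_lt (max_lt (hsm _ _ _ _) (hsm _ _ _ _))))
    have hm : ((X - C μ) * ((X - C lam) * q (s + 1) (t + 1) (2 * n))).Monic :=
      (monic_X_sub_C μ).mul ((monic_X_sub_C lam).mul ((hq _ _).monic _))
    have hnd : ((X - C μ) * ((X - C lam) * q (s + 1) (t + 1) (2 * n))).natDegree =
        2 * n + 1 + 1 := by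
      rw [(monic_X_sub_C μ).natDegree_mul ((monic_X_sub_C lam).mul ((hq _ _).monic _)),
        (monic_X_sub_C lam).natDegree_mul ((hq _ _).monic _), natDegree_X_sub_C,
        natDegree_X_sub_C, (hq _ _).natDegree_eq]
      ring
    have hone : ((X - C μ) * ((X - C lam) * q (s + 1) (t + 1) (2 * n))).coeff
        (2 * n + 1 + 1) = 1 := by
      rwa [Monic, leadingCoeff, hnd] at hm
    have := degree_sub_coeff_mul_lt (m := 2 * n + 1 + 1)
      (degree_X_sub_C_mul_lt μ (degree_X_sub_C_mul_lt lam (hlt (s + 1) (t + 1))))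
      ((hq s t).monic (2 * (n + 1))) ((hq s t).natDegree_eq _)
    rwa [hone, C_1, one_mul] at this
  have hR0 : R = 0 := by
    rw [hR] at hPdeg
    refine (hq (s + 1) (t + 1)).eq_zero_of_orthogonal (hB.skew _ _) n
      (degree_lt_of_degree_X_sub_C_mul_lt lam (degree_lt_of_degree_X_sub_C_mul_lt μ hPdeg))
      fun g hg => ?_
    have hg' : g.degree < ((2 * n + 1 : ℕ) : WithBot ℕ) :=
      hg.trans (by exact_mod_cast Nat.lt_succ_self _)
    rw [hB.step_st, ← hR, hP, mul_left_comm (X - C lam), mul_left_comm (X - C μ) (C d)]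
    simp only [map_sub, ← smul_eq_C_mul, map_smul, LinearMap.sub_apply, LinearMap.smul_apply]
    rw [← hB.step_st, hB.pairing_X_sub_mu_mul, hB.pairing_X_sub_lam_mul,
      (hq _ _).even_orthogonal n hg', (hq _ _).even_orthogonal n (degree_X_sub_C_mul_lt _ hg),
      (hq _ _).even_orthogonal n (degree_X_sub_C_mul_lt _ hg),
      (hq s t).even_orthogonal (n + 1)]
    · simp
    · exact degree_X_sub_C_mul_lt _ (degree_X_sub_C_mul_lt _ hg')
  have hP0 : P = 0 := by rw [hR, hR0, mul_zero, mul_zero]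
  rw [hqq, mul_assoc]
  exact sub_eq_zero.1 hP0

end IsTimeEvolution

end SkewOP

theorem theorem3 {K : Type*} [RCLike K] (μ lam : K) (hne : lam ≠ μ)
    (B : ℕ → ℕ → LinearMap.BilinForm K (Polynomial K))
    (hB : SkewOP.IsTimeEvolution μ lam B)
    (q : ℕ → ℕ → ℕ → Polynomial K)
    (hq : ∀ s t : ℕ, SkewOP.IsSOP (B s t) (q s t)) :
    (∀ s t n : ℕ, SkewOP.tau (B s t) n ≠ 0) ∧
    ∀ s t n : ℕ,
      ((X - C lam) * q s (t + 1) (2 * n) - (X - C μ) * q (s + 1) t (2 * n) =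
        (X - C μ) * (X - C lam) *
            (C (SkewOP.coeffA μ lam B s t n) * SkewOP.evenPred (q (s + 1) (t + 1)) n) -
          C (SkewOP.coeffB μ lam B s t n) * q s t (2 * n)) ∧
      ((X - C μ) * (X - C lam) * q (s + 1) (t + 1) (2 * n) - q s t (2 * n + 2) =
        (X - C lam) * (C (SkewOP.coeffC μ lam B s t n) * q s (t + 1) (2 * n)) -
          (X - C μ) * (C (SkewOP.coeffD μ lam B s t n) * q (s + 1) t (2 * n))) := by
  exact ⟨fun s t n => (hq s t).tau_ne_zero (hB.skew s t) n, fun s t n =>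
    ⟨hB.first_relation hne hq s t n, hB.second_relation hne hq s t n⟩⟩
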